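/- **Setting.** Let $\alpha$ be a finite set with an involution $\tau$. A nanoword $w$ over $\alpha$ is a finite alphabet $\mathcal A$ with a projection $\mathcal A\to\alpha$, $A\mapsto|A|$, and a word in which every letter of $\mathcal A$ occurs exactly twice; a nanophrase is such a word cut into a finite sequence of words. Let $\operatorname{crs}(\alpha/\tau)$ be a complete residue system of $\alpha/\tau$ and $L\subset\operatorname{crs}(\alpha/\tau)$. For a nanophrase $P$ over $\alpha$, let $\mathcal U_L(P)$ be the nanophrase over $\{1,-1\}$ obtained from $P$ by giving a letter $A$ with $\tau(|A|)\ne|A|$ the projection $1$ if $|A|\in L$ and $-1$ if $|A|\in\tau(L)$, and deleting all other letters. *Khovanov homology.* For a nanophrase $P$ over $\{1,-1\}$, a state assigns a marker $\pm1$ to each letter. Regard the components of $P$ as closed oriented curves cut into arcs by their letters (an empty component is one closed arc). At the two places of a letter $A$, join each incoming arc to the outgoing arc of the other place if $\mathrm{mark}(A)=|A|$, and join the two incoming arcs together and the two outgoing arcs together if $\mathrm{mark}(A)=-|A|$; this produces circles. An enhanced state $S$ is a state with a sign for each circle. Let $w(P)=\sum_A|A|$, $\sigma(S)=\sum_A\mathrm{mark}(A)$,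 let $\tau(S)$ be the sum of the signs of the circles, $i(S)=\frac{w(P)-\sigma(S)}2$ and $j(S)=-\frac{\sigma(S)+2\tau(S)-3w(P)}2$. Let $C^{i,j}(P)$ be the $\mathbb Z/2$-vector space on the enhanced states of bidegree $(i,j)$, with $d(S)=\sum_T(S:T)\,T$, where $(S:T)=1$ if the markers of $S$ and $T$ differ at exactly one letter $A$, where that of $S$ is $+$ and that of $T$ is $-$, the circles not passing through $A$ keep their signs, and at $A$ either two circles merge into one with signs $(-,-)\to-$ or $(+,-)\to+$ or $(-,+)\to+$, or one circle splits into two with signs $+\to(+,+)$ or $-\to(+,-)$ or $-\to(-,+)$; otherwise $(S:T)=0$. Then $KH^{i,j}(P)=\operatorname{Ker}d^{i}/\operatorname{Im}d^{i-1}$. *Turaev's invariants.* An $\alpha$-kei is a set with maps $x\mapsto ax$ and binary operations $*_a$ $(a\in\alpha)$ such that $a\,\tau(a)x=x$, $a(x*_ay)=ax*_aay$, $ax*_ax=x$, $(x*_ay)*_{\tau(a)}ay=x$ and $(x*_ay)*_az=(x*_aaz)*_a(y*_az)$. For a nanoword $w$ over $\alpha$, read $w$ from left to right, starting with the label $x_0$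 that generates the free $\alpha$-kei of rank one: at the first occurrence of $A$ the current label $x$ becomes $|A|x$, and at the second occurrence it becomes $x*_{|A|}y$, where $y$ is the label just before the first occurrence of $A$. The final label is $v_+(w)$. Let $\Psi$ be the group with generators $a,a_\bullet$ $(a\in\alpha)$ and relations $a\tau(a)=a_\bullet\tau(a)_\bullet=1$, $aa_\bullet=a_\bullet a$. Let $F$ be the free group with basis $\{\underline h\}_{h\in\Psi}$, on which $\Psi$ acts by $g\cdot\underline h=\underline{gh}$; it is an $\alpha$-kei with $ax=a\cdot x$, $x*_ay=a_\bullet\cdot\bigl(x\,(a\cdot y)^{-1}\bigr)\,y$, and $f$ is the homomorphism of $\alpha$-keis from the free $\alpha$-kei to $F$ with $f(x_0)=\underline 1$. The group ring $\mathbb Z[\Psi]$ is an $\alpha$-kei with $x\mapsto ax$, $x*_ay=a_\bullet x+(1-a_\bullet a)y$, and $\lambda(w)$ is the image of $v_+(w)$ under the homomorphism with $x_0\mapsto1$. **Theorem.** Let $\alpha$ be a finite set with an involution $\tau$, let $L\subset\operatorname{crs}(\alpha/\tau)$, and suppose that some $c\in L$ satisfies $\tau(c)\ne c$. (For instance, $L=\{c\}$.)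 Then $KH^{i,j}(\mathcal U_L(\cdot))$ is not determined by $f\circ v_+$: it is not true that for all nanowords $w,w'$ over $\alpha$ with $f(v_+(w))=f(v_+(w'))$ one has $KH^{i,j}(\mathcal U_L(w))\cong KH^{i,j}(\mathcal U_L(w'))$ for all $i,j\in\mathbb Z$. More precisely: 1. For the nanoword $ABCDCDAB$ with $|A|=|B|=\tau(c)$, $|C|=|D|=c$, one has $$f(v_+(ABCDCDAB))=f(v_+(\emptyset))=\underline 1,\qquad KH^{1,3}(\mathcal U_L(\emptyset))=0,\qquad KH^{1,3}(\mathcal U_L(ABCDCDAB))\cong\mathbb Z/2 .$$ 2. For the nanowords $ABACBC$ and $ACAC$ with $|A|=|C|=c$, $|B|=\tau(c)$, one has $$\lambda(ABACBC)=\lambda(ACAC),\qquad KH^{0,2}(\mathcal U_L(ACAC))=0,\qquad KH^{0,2}(\mathcal U_L(ABACBC))\cong\mathbb Z/2 .$$ -/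

import Mathlib

/-! ## Nanophrases and nanowords -/

/-- A nanophrase over `α` on the alphabet `𝒜`: a projection `𝒜 → α`, `A ↦ |A|`, and a sequence of
words in which every letter of `𝒜` occurs exactly twice in total. -/
structure Nanophrase (𝒜 : Type*) [DecidableEq 𝒜] (α : Type*) where
  proj : 𝒜 → α
  words : List (List 𝒜)
  gauss : ∀ A : 𝒜, words.flatten.count A = 2

/-- A nanoword over `α` on the alphabet `𝒜`. -/
structure Nanoword (𝒜 : Type*) [DecidableEq 𝒜] (α : Type*) where
  proj : 𝒜 → α
  word : List 𝒜
  gauss : ∀ A : 𝒜, word.count A = 2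

/-- A nanoword, seen as a nanophrase of length one. -/
def Nanoword.toNanophrase {𝒜 : Type*} [DecidableEq 𝒜] {α : Type*} (w : Nanoword 𝒜 α) :
    Nanophrase 𝒜 α where
  proj := w.proj
  words := [w.word]
  gauss := by simpa using w.gauss

/-- The empty nanoword. -/
def emptyNanoword (α : Type*) : Nanoword (Fin 0) α where
  proj := Fin.elim0
  word := []
  gauss := fun A => A.elim0

/-- The nanoword `ABCDCDAB` with `|A| = a`, `|B| = b`, `|C| = c`, `|D| = d`. -/
def nanowordABCDCDAB {α : Type*} (a b c d : α) : Nanoword (Fin 4) α where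
  proj := ![a, b, c, d]
  word := [0, 1, 2, 3, 2, 3, 0, 1]
  gauss := by decide

/-- The nanoword `ABACBC` with `|A| = a`, `|B| = b`, `|C| = c`. -/
def nanowordABACBC {α : Type*} (a b c : α) : Nanoword (Fin 3) α where
  proj := ![a, b, c]
  word := [0, 1, 0, 2, 1, 2]
  gauss := by decide

/-- The nanoword `ACAC` with `|A| = a`, `|C| = c`. -/
def nanowordACAC {α : Type*} (a c : α) : Nanoword (Fin 2) α where
  proj := ![a, c]
  word := [0, 1, 0, 1]
  gauss := by decide

/-! ## The reduction `U_L` of nanophrases over `α` to nanophrases over `{1, -1}` -/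

/-- `R` is a complete residue system of `α / τ`: it meets every orbit `{a, τ a}` of the involution
`τ` in exactly one element. -/
def IsCompleteResidueSystem {α : Type*} (τ : α → α) (R : Set α) : Prop :=
  ∀ a : α, ∃! r : α, r ∈ R ∧ (r = a ∨ r = τ a)

open Classical in
/-- The sign of a letter with projection `a`. -/
noncomputable def signL {α : Type*} (τ : α → α) (L : Set α) (a : α) : ℤ :=
  if a ∈ L ∧ τ a ≠ a then 1 else if a ∈ τ '' L ∧ τ a ≠ a then -1 else 0

/-- The letters of the nanophrase `P` of non-zero sign. -/
abbrev SignedLetter {𝒜 : Type*} [DecidableEq 𝒜] {α : Type*} (τ : α → α) (L : Set α)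
    (P : Nanophrase 𝒜 α) : Type _ :=
  {A : 𝒜 // signL τ L (P.proj A) ≠ 0}

theorem count_filterMap_subtype {𝒜 : Type*} [DecidableEq 𝒜] (p : 𝒜 → Prop) [DecidablePred p]
    (l : List 𝒜) (B : {A : 𝒜 // p A}) :
    @List.count _ instBEqOfDecidableEq B (l.filterMap fun A => if h : p A then some (⟨A, h⟩ : {A : 𝒜 // p A}) else none)
      = l.count B.1 := by
  induction l with
  | nil => simp
  | cons A l ih =>
    by_cases h : p A
    · simp only [List.filterMap_cons, h, dite_true, List.count_cons, ih]
      by_cases hA : A = B.1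
      · subst hA; simp
      · have : (⟨A, h⟩ : {A : 𝒜 // p A}) ≠ B := fun e => hA (congrArg Subtype.val e)
        simp [hA, this]
    · have hA : A ≠ B.1 := fun e => h (e ▸ B.2)
      simp only [List.filterMap_cons, h, dite_false, List.count_cons, ih]
      simp [hA]

/-- The nanophrase `U_L(P)` over `{1, -1}`: remove the letters of sign `0` from `P`, and let the
projection of every remaining letter be its sign. -/
noncomputable def reduceL {𝒜 : Type*} [DecidableEq 𝒜] {α : Type*} (τ : α → α) (L : Set α)
    (P : Nanophrase 𝒜 α) : Nanophrase (SignedLetter τ L P) ℤˣ where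
  proj := fun A => if signL τ L (P.proj A.1) = 1 then 1 else -1
  words := P.words.map fun w => w.filterMap fun A =>
    if h : signL τ L (P.proj A) ≠ 0 then some ⟨A, h⟩ else none
  gauss := fun B => by
    rw [← List.filterMap_flatten]
    exact (count_filterMap_subtype (fun A => signL τ L (P.proj A) ≠ 0) _ B).trans (P.gauss B.1)

/-! ## Khovanov homology with coefficients in `ℤ/2` of nanophrases over `{1, -1}` -/

namespace Nanophrase

variable {𝒜 : Type*} [DecidableEq 𝒜]

/-- The places of the letters in the phrase: a component and a place in it. -/
abbrev Place (P : Nanophrase 𝒜 ℤˣ) : Type :=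
  (k : Fin P.words.length) × Fin (P.words.get k).length

/-- The letter at a place. -/
def letter (P : Nanophrase 𝒜 ℤˣ) (p : P.Place) : 𝒜 := (P.words.get p.1).get p.2

/-- The arcs into which the letters cut the components, each component being regarded as a closed
curve: a component of length `n ≥ 1` has `n` arcs, the `i`-th of which ends at the `i`-th place, and
an empty component has a single arc, which is closed. -/
abbrev Arc (P : Nanophrase 𝒜 ℤˣ) : Type :=
  (k : Fin P.words.length) × Fin (max 1 (P.words.get k).length)

/-- The arc that ends at the given place. -/
def arcIn (P : Nanophrase 𝒜 ℤˣ) (p : P.Place) : P.Arc :=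
  ⟨p.1, ⟨p.2.1, lt_max_of_lt_right p.2.2⟩⟩

/-- The arc that starts at the given place (cyclically, within its component). -/
def arcOut (P : Nanophrase 𝒜 ℤˣ) (p : P.Place) : P.Arc :=
  ⟨p.1, ⟨(p.2.1 + 1) % (P.words.get p.1).length,
    lt_max_of_lt_right (Nat.mod_lt _ (Nat.zero_lt_of_lt p.2.2))⟩⟩

/-- How the arcs are joined when all letters are deleted according to the markers `s`. At the two
places `p`, `q` of a letter `A`:
* if `mark(A) = |A|`, the word `x` between the two occurrences closes up and is split off
  (`AxAy → x | y`), or two components are concatenated (`Ax | Ay → xy`): each incoming arc is joined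
  to the outgoing arc at the other place;
* if `mark(A) = -|A|`, the word `x` is reversed (`AxAy → x⁻y`, `Ax | Ay → x⁻y`): the two incoming
  arcs are joined and the two outgoing arcs are joined.

The change of projections that accompanies the reversal of `x` in the word notation keeps the
rule independent of the direction in which a stretch is read, so that all letters can be
deleted simultaneously in terms of the original directions and the original projections. -/
inductive Joined (P : Nanophrase 𝒜 ℤˣ) (s : 𝒜 → ℤˣ) : P.Arc → P.Arc → Prop
  | along (p q : P.Place) (hne : p ≠ q) (hl : P.letter p = P.letter q)
      (hs : s (P.letter p) = P.proj (P.letter p)) : Joined P s (P.arcIn p) (P.arcOut q)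
  | ends (p q : P.Place) (hne : p ≠ q) (hl : P.letter p = P.letter q)
      (hs : s (P.letter p) = -P.proj (P.letter p)) : Joined P s (P.arcIn p) (P.arcIn q)
  | starts (p q : P.Place) (hne : p ≠ q) (hl : P.letter p = P.letter q)
      (hs : s (P.letter p) = -P.proj (P.letter p)) : Joined P s (P.arcOut p) (P.arcOut q)

/-- The components `∅ | ⋯ | ∅` that remain after deleting all letters according to the state with
markers `s`: the classes of arcs under the equivalence relation generated by `Joined`. -/
def Circle (P : Nanophrase 𝒜 ℤˣ) (s : 𝒜 → ℤˣ) : Type := Quot (P.Joined s)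

/-- The component which contains the given arc. -/
def circleOf (P : Nanophrase 𝒜 ℤˣ) (s : 𝒜 → ℤˣ) (e : P.Arc) : P.Circle s := Quot.mk _ e

noncomputable instance (P : Nanophrase 𝒜 ℤˣ) (s : 𝒜 → ℤˣ) : Fintype (P.Circle s) :=
  haveI : Finite (P.Circle s) := Quot.finite _
  Fintype.ofFinite _

/-- The components that carry the trace of the letter `A`. -/
def circlesAt (P : Nanophrase 𝒜 ℤˣ) (s : 𝒜 → ℤˣ) (A : 𝒜) : Set (P.Circle s) :=
  {c | ∃ p : P.Place, P.letter p = A ∧ (c = P.circleOf s (P.arcIn p) ∨ c = P.circleOf s (P.arcOut p))}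

/-- An enhanced state: a marker for every letter, and a sign for every remaining component. -/
def EnhancedState (P : Nanophrase 𝒜 ℤˣ) : Type _ := (s : 𝒜 → ℤˣ) × (P.Circle s → ℤˣ)

namespace EnhancedState

/-- The markers of an enhanced state. -/
def mark {P : Nanophrase 𝒜 ℤˣ} (S : P.EnhancedState) : 𝒜 → ℤˣ := S.1

/-- The signs of the components of an enhanced state. -/
def sgn {P : Nanophrase 𝒜 ℤˣ} (S : P.EnhancedState) : P.Circle S.mark → ℤˣ := S.2

end EnhancedState

noncomputable instance [Fintype 𝒜] (P : Nanophrase 𝒜 ℤˣ) : Fintype P.EnhancedState := by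
  classical
  exact inferInstanceAs (Fintype ((s : 𝒜 → ℤˣ) × (P.Circle s → ℤˣ)))

/-- `w(P)`, the sum of the projections of the letters. -/
def writhe [Fintype 𝒜] (P : Nanophrase 𝒜 ℤˣ) : ℤ := ∑ A : 𝒜, (P.proj A : ℤ)

namespace EnhancedState

/-- `σ(S)`, the number of positive markers minus the number of negative markers. -/
def sigma [Fintype 𝒜] {P : Nanophrase 𝒜 ℤˣ} (S : P.EnhancedState) : ℤ := ∑ A : 𝒜, (S.mark A : ℤ)

/-- `τ(S)`, the number of positive components minus the number of negative components. -/
noncomputable def tau {P : Nanophrase 𝒜 ℤˣ} (S : P.EnhancedState) : ℤ :=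
  ∑ c : P.Circle S.mark, (S.sgn c : ℤ)

/-- `i(S) = (w(P) - σ(S)) / 2`; the numerator is always even. -/
def degI [Fintype 𝒜] {P : Nanophrase 𝒜 ℤˣ} (S : P.EnhancedState) : ℤ := (P.writhe - S.sigma) / 2

/-- `j(S) = -(σ(S) + 2 τ(S) - 3 w(P)) / 2`; the numerator is always even. -/
noncomputable def degJ [Fintype 𝒜] {P : Nanophrase 𝒜 ℤˣ} (S : P.EnhancedState) : ℤ :=
  -((S.sigma + 2 * S.tau - 3 * P.writhe) / 2)

/-- At the letter `A`, two components `c₁`, `c₂` of `S` become one component `c` of `T`, with signs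
`-, - → -`, or `-, + → +`, or `+, - → +`. -/
def Merges {P : Nanophrase 𝒜 ℤˣ} (S T : P.EnhancedState) (A : 𝒜) : Prop :=
  ∃ c₁ c₂ : P.Circle S.mark, ∃ c : P.Circle T.mark, c₁ ≠ c₂ ∧
    P.circlesAt S.mark A = {c₁, c₂} ∧ P.circlesAt T.mark A = {c} ∧
    ((S.sgn c₁ = -1 ∧ S.sgn c₂ = -1 ∧ T.sgn c = -1) ∨
     (S.sgn c₁ = -1 ∧ S.sgn c₂ = 1 ∧ T.sgn c = 1) ∨
     (S.sgn c₁ = 1 ∧ S.sgn c₂ = -1 ∧ T.sgn c = 1))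

/-- At the letter `A`, one component `c` of `S` becomes two components `c₁`, `c₂` of `T`, with signs
`+ → +, +`, or `- → +, -`, or `- → -, +`. -/
def Splits {P : Nanophrase 𝒜 ℤˣ} (S T : P.EnhancedState) (A : 𝒜) : Prop :=
  ∃ c : P.Circle S.mark, ∃ c₁ c₂ : P.Circle T.mark, c₁ ≠ c₂ ∧
    P.circlesAt S.mark A = {c} ∧ P.circlesAt T.mark A = {c₁, c₂} ∧
    ((S.sgn c = 1 ∧ T.sgn c₁ = 1 ∧ T.sgn c₂ = 1) ∨
     (S.sgn c = -1 ∧ T.sgn c₁ = 1 ∧ T.sgn c₂ = -1) ∨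
     (S.sgn c = -1 ∧ T.sgn c₁ = -1 ∧ T.sgn c₂ = 1))

/-- The pairs with `(S : T) = 1`: the markers of `S` and `T` differ at exactly one letter `A`, where
that of `S` is positive and that of `T` is negative; the components without trace of `A` keep their
signs; and at `A` two components merge or one splits according to the sign rules. -/
def Incident {P : Nanophrase 𝒜 ℤˣ} (S T : P.EnhancedState) : Prop :=
  ∃ A : 𝒜, S.mark A = 1 ∧ T.mark A = -1 ∧ (∀ B : 𝒜, B ≠ A → S.mark B = T.mark B) ∧
    (∀ e : P.Arc, P.circleOf S.mark e ∉ P.circlesAt S.mark A →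
      S.sgn (P.circleOf S.mark e) = T.sgn (P.circleOf T.mark e)) ∧
    (Merges S T A ∨ Splits S T A)

open Classical in
/-- The incidence number `(S : T)` modulo 2. -/
noncomputable def incidence {P : Nanophrase 𝒜 ℤˣ} (S T : P.EnhancedState) : ZMod 2 :=
  if Incident S T then 1 else 0

end EnhancedState

variable [Fintype 𝒜]

/-- The enhanced states of bidegree `(i, j)`. -/
abbrev StateOfDeg (P : Nanophrase 𝒜 ℤˣ) (i j : ℤ) : Type _ :=
  {S : P.EnhancedState // S.degI = i ∧ S.degJ = j}

/-- The chain group `C^{i,j}(P; ℤ/2)`. -/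
abbrev Chain (P : Nanophrase 𝒜 ℤˣ) (i j : ℤ) : Type _ := P.StateOfDeg i j →₀ ZMod 2

/-- The component `C^{i,j} → C^{i',j}` of the differential `d(S) = ∑_T (S : T) T`; it is used
for `i' = i + 1`. -/
noncomputable def differential (P : Nanophrase 𝒜 ℤˣ) (i i' j : ℤ) :
    P.Chain i j →+ P.Chain i' j :=
  (Finsupp.linearCombination (ZMod 2) fun S : P.StateOfDeg i j =>
    ∑ T : P.StateOfDeg i' j, Finsupp.single T (S.1.incidence T.1)).toAddMonoidHom

/-- The Khovanov homology group `KH^{i,j}(P) = Ker d^i / Im d^{i-1}`. -/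
abbrev KH (P : Nanophrase 𝒜 ℤˣ) (i j : ℤ) : Type _ :=
  (P.differential i (i + 1) j).ker ⧸
    (P.differential (i - 1) i j).range.addSubgroupOf (P.differential i (i + 1) j).ker

end Nanophrase

/-! ## `α`-keis and Turaev's invariants `v_+`, `f ∘ v_+` and `λ` of nanowords -/

/-- An `α`-kei structure on `X`, for a set `α` with involution `τ`: maps `x ↦ a x` and operations
`(x, y) ↦ x *_a y` for `a ∈ α`. -/
structure AlphaKei {α : Type*} (τ : α → α) (X : Type*) where
  act : α → X → X
  op : α → X → X → X
  act_act : ∀ a x, act a (act (τ a) x) = x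
  act_op : ∀ a x y, act a (op a x y) = op a (act a x) (act a y)
  op_self : ∀ a x, op a (act a x) x = x
  op_op_inv : ∀ a x y, op (τ a) (op a x y) (act a y) = x
  op_op : ∀ a x y z, op a (op a x y) z = op a (op a x (act a z)) (op a y z)

/-- Formal expressions in one generator. -/
inductive KeiTerm (α : Type*)
  | base : KeiTerm α
  | act : α → KeiTerm α → KeiTerm α
  | op : α → KeiTerm α → KeiTerm α → KeiTerm α

/-- The relations between formal expressions imposed by the axioms of an `α`-kei. -/
inductive KeiRel {α : Type*} (τ : α → α) : KeiTerm α → KeiTerm α → Prop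
  | act_act (a x) : KeiRel τ (.act a (.act (τ a) x)) x
  | act_op (a x y) : KeiRel τ (.act a (.op a x y)) (.op a (.act a x) (.act a y))
  | op_self (a x) : KeiRel τ (.op a (.act a x) x) x
  | op_op_inv (a x y) : KeiRel τ (.op (τ a) (.op a x y) (.act a y)) x
  | op_op (a x y z) :
      KeiRel τ (.op a (.op a x y) z) (.op a (.op a x (.act a z)) (.op a y z))
  | congr_act (a) {x x'} (h : KeiRel τ x x') : KeiRel τ (.act a x) (.act a x')
  | congr_left (a) {x x'} (y) (h : KeiRel τ x x') : KeiRel τ (.op a x y) (.op a x' y)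
  | congr_right (a) (x) {y y'} (h : KeiRel τ y y') : KeiRel τ (.op a x y) (.op a x y')

/-- The free `α`-kei on one generator. -/
def FreeKei {α : Type*} (τ : α → α) : Type _ := Quot (KeiRel τ)

namespace FreeKei

variable {α : Type*} {τ : α → α}

/-- The generator. -/
def gen : FreeKei τ := Quot.mk _ .base

/-- The `α`-kei structure of the free `α`-kei. -/
def kei (τ : α → α) : AlphaKei τ (FreeKei τ) where
  act a := Quot.map (.act a) fun _ _ h => .congr_act a h
  op a := Quot.map₂ (.op a) (fun x _ _ h => .congr_right a x h) (fun _ _ y h => .congr_left a y h)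
  act_act := by rintro a ⟨x⟩; exact Quot.sound (.act_act a x)
  act_op := by rintro a ⟨x⟩ ⟨y⟩; exact Quot.sound (.act_op a x y)
  op_self := by rintro a ⟨x⟩; exact Quot.sound (.op_self a x)
  op_op_inv := by rintro a ⟨x⟩ ⟨y⟩; exact Quot.sound (.op_op_inv a x y)
  op_op := by rintro a ⟨x⟩ ⟨y⟩ ⟨z⟩; exact Quot.sound (.op_op a x y z)

/-- The value of a formal expression in an `α`-kei, given the value of the generator. -/
def eval {X : Type*} (K : AlphaKei τ X) (x₀ : X) : KeiTerm α → X
  | .base => x₀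
  | .act a x => K.act a (eval K x₀ x)
  | .op a x y => K.op a (eval K x₀ x) (eval K x₀ y)

/-- The homomorphism of `α`-keis from the free `α`-kei which sends the generator to `x₀`. -/
def lift {X : Type*} (K : AlphaKei τ X) (x₀ : X) : FreeKei τ → X :=
  Quot.lift (eval K x₀) fun x y h => by
    induction h with
    | act_act a x => exact K.act_act _ _
    | act_op a x y => exact K.act_op _ _ _
    | op_self a x => exact K.op_self _ _
    | op_op_inv a x y => exact K.op_op_inv _ _ _
    | op_op a x y z => exact K.op_op _ _ _ _
    | congr_act a h ih => exact congrArg (K.act a) ih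
    | congr_left a y h ih => exact congrArg (fun t => K.op a t (eval K x₀ y)) ih
    | congr_right a x h ih => exact congrArg (K.op a (eval K x₀ x)) ih

end FreeKei

/-- The label after reading a word, from left to right, in an `α`-kei: `x` is the current label and
`m` stores, for each letter met so far, the label in front of its first occurrence. At the first
occurrence of `A` the label `x` becomes `|A| x`; at the second one it becomes `x *_{|A|} y`, where
`y` is the label in front of the first occurrence of `A`. -/
def keiWalk {α 𝒜 X : Type*} [DecidableEq 𝒜] {τ : α → α} (K : AlphaKei τ X) (proj : 𝒜 → α) :
    List 𝒜 → (𝒜 → Option X) → X → X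
  | [], _, x => x
  | A :: w, m, x =>
    match m A with
    | none => keiWalk K proj w (Function.update m A (some x)) (K.act (proj A) x)
    | some y => keiWalk K proj w m (K.op (proj A) x y)

/-- The final label `v_+(w)` in the free `α`-kei on the initial label. -/
def vPlus {α 𝒜 : Type*} [DecidableEq 𝒜] (τ : α → α) (w : Nanoword 𝒜 α) : FreeKei τ :=
  keiWalk (FreeKei.kei τ) w.proj w.word (fun _ => none) FreeKei.gen

/-- The defining relations `a τ(a) = 1`, `a_• τ(a)_• = 1`, `a a_• = a_• a` of the group `Ψ`; here
`Sum.inl a` stands for the generator `a` and `Sum.inr a` for the generator `a_•`. -/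
def psiRels {α : Type*} (τ : α → α) : Set (FreeGroup (α ⊕ α)) :=
  {r | ∃ a : α,
    r = FreeGroup.of (Sum.inl a) * FreeGroup.of (Sum.inl (τ a)) ∨
    r = FreeGroup.of (Sum.inr a) * FreeGroup.of (Sum.inr (τ a)) ∨
    r = FreeGroup.of (Sum.inl a) * FreeGroup.of (Sum.inr a) *
      (FreeGroup.of (Sum.inl a))⁻¹ * (FreeGroup.of (Sum.inr a))⁻¹}

/-- The group `Ψ` with generators `a`, `a_•` for `a ∈ α`. -/
abbrev Psi {α : Type*} (τ : α → α) : Type _ := PresentedGroup (psiRels τ)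

namespace Psi

variable {α : Type*} {τ : α → α}

/-- The generator `a` of `Ψ`. -/
def plain (τ : α → α) (a : α) : Psi τ := PresentedGroup.of (Sum.inl a)

/-- The generator `a_•` of `Ψ`. -/
def dot (τ : α → α) (a : α) : Psi τ := PresentedGroup.of (Sum.inr a)

theorem plain_mul (a : α) : plain τ a * plain τ (τ a) = 1 :=
  PresentedGroup.one_of_mem (rels := psiRels τ) ⟨a, Or.inl rfl⟩

theorem dot_mul (a : α) : dot τ a * dot τ (τ a) = 1 :=
  PresentedGroup.one_of_mem (rels := psiRels τ) ⟨a, Or.inr (Or.inl rfl)⟩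

theorem plain_tau (a : α) : plain τ (τ a) = (plain τ a)⁻¹ :=
  eq_inv_of_mul_eq_one_right (plain_mul a)

theorem dot_tau (a : α) : dot τ (τ a) = (dot τ a)⁻¹ :=
  eq_inv_of_mul_eq_one_right (dot_mul a)

theorem comm (a : α) : plain τ a * dot τ a = dot τ a * plain τ a :=
  mul_inv_eq_iff_eq_mul.mp (mul_inv_eq_one.mp
    (PresentedGroup.one_of_mem (rels := psiRels τ) ⟨a, Or.inr (Or.inr rfl)⟩))

/-- The action of `g ∈ Ψ` on the free group with basis `{h̲ : h ∈ Ψ}`, given by `h̲ ↦ g̲h̲`. -/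
def shift (g : Psi τ) : FreeGroup (Psi τ) →* FreeGroup (Psi τ) := FreeGroup.map (g * ·)

theorem shift_shift (g h : Psi τ) (x : FreeGroup (Psi τ)) :
    shift g (shift h x) = shift (g * h) x := by
  simp only [shift, FreeGroup.map.comp]
  congr 2
  funext k
  simp [mul_assoc]

theorem shift_one (x : FreeGroup (Psi τ)) : shift (1 : Psi τ) x = x := by
  simp [shift]

end Psi

/-- The `α`-kei structure `a x = a · x`, `x *_a y = a_• · (x (a · y)⁻¹) y` on the free group with
basis `{h̲ : h ∈ Ψ}`. -/
def groupKei {α : Type*} (τ : α → α) : AlphaKei τ (FreeGroup (Psi τ)) where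
  act a x := Psi.shift (Psi.plain τ a) x
  op a x y := Psi.shift (Psi.dot τ a) (x * (Psi.shift (Psi.plain τ a) y)⁻¹) * y
  act_act a x := by simp [Psi.shift_shift, Psi.plain_mul, Psi.shift_one]
  act_op a x y := by
    have h : Psi.plain τ a * (Psi.dot τ a * Psi.plain τ a) =
        Psi.dot τ a * (Psi.plain τ a * Psi.plain τ a) := by
      rw [← mul_assoc, Psi.comm, mul_assoc]
    simp [Psi.shift_shift, Psi.comm, mul_assoc, h]
  op_self a x := by simp
  op_op_inv a x y := by
    simp [Psi.shift_shift, Psi.plain_tau, Psi.dot_tau, Psi.shift_one]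
  op_op a x y z := by
    have h : Psi.plain τ a * (Psi.dot τ a * Psi.plain τ a) =
        Psi.dot τ a * (Psi.plain τ a * Psi.plain τ a) := by
      rw [← mul_assoc, Psi.comm, mul_assoc]
    simp [Psi.shift_shift, Psi.comm, mul_assoc, h]

/-- Turaev's invariant `f ∘ v_+`: the homomorphism `f` of `α`-keis sends the generator of the free
`α`-kei to the basis element `1̲`. -/
def fvPlus {α 𝒜 : Type*} [DecidableEq 𝒜] (τ : α → α) (w : Nanoword 𝒜 α) : FreeGroup (Psi τ) :=
  FreeKei.lift (groupKei τ) (FreeGroup.of 1) (vPlus τ w)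

/-- The `α`-kei structure `a x`, `x *_a y = a_• x + (1 - a_• a) y` on the group ring `ℤ[Ψ]`. -/
noncomputable def linearKei {α : Type*} (τ : α → α) : AlphaKei τ (MonoidAlgebra ℤ (Psi τ)) where
  act a x := MonoidAlgebra.of ℤ _ (Psi.plain τ a) * x
  op a x y := MonoidAlgebra.of ℤ _ (Psi.dot τ a) * x +
    (1 - MonoidAlgebra.of ℤ _ (Psi.dot τ a) * MonoidAlgebra.of ℤ _ (Psi.plain τ a)) * y
  act_act a x := by
    rw [← mul_assoc, ← map_mul, Psi.plain_mul, map_one, one_mul]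
  act_op a x y := by
    have h : MonoidAlgebra.of ℤ _ (Psi.plain τ a) * MonoidAlgebra.of ℤ _ (Psi.dot τ a) =
        MonoidAlgebra.of ℤ _ (Psi.dot τ a) * MonoidAlgebra.of ℤ _ (Psi.plain τ a) := by
      rw [← map_mul, ← map_mul, Psi.comm]
    generalize MonoidAlgebra.of ℤ _ (Psi.plain τ a) = p at *
    generalize MonoidAlgebra.of ℤ _ (Psi.dot τ a) = d at *
    simp only [mul_add, sub_mul, mul_sub, one_mul, ← mul_assoc, h]
  op_self a x := by
    simp only [sub_mul, one_mul, ← mul_assoc]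
    abel
  op_op_inv a x y := by
    have h1 : MonoidAlgebra.of ℤ _ (Psi.dot τ (τ a)) * MonoidAlgebra.of ℤ _ (Psi.dot τ a) =
        1 := by
      rw [← map_mul, Psi.dot_tau, inv_mul_cancel, map_one]
    have h2 : MonoidAlgebra.of ℤ _ (Psi.plain τ (τ a)) * MonoidAlgebra.of ℤ _ (Psi.plain τ a) =
        1 := by
      rw [← map_mul, Psi.plain_tau, inv_mul_cancel, map_one]
    generalize MonoidAlgebra.of ℤ _ (Psi.plain τ a) = p at *
    generalize MonoidAlgebra.of ℤ _ (Psi.dot τ a) = d at *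
    generalize MonoidAlgebra.of ℤ _ (Psi.plain τ (τ a)) = p' at *
    generalize MonoidAlgebra.of ℤ _ (Psi.dot τ (τ a)) = d' at *
    simp only [mul_add, sub_mul, mul_sub, one_mul, ← mul_assoc, h1]
    simp only [mul_assoc, h2, mul_one]
    abel
  op_op a x y z := by
    have h : MonoidAlgebra.of ℤ _ (Psi.plain τ a) * MonoidAlgebra.of ℤ _ (Psi.dot τ a) =
        MonoidAlgebra.of ℤ _ (Psi.dot τ a) * MonoidAlgebra.of ℤ _ (Psi.plain τ a) := by
      rw [← map_mul, ← map_mul, Psi.comm]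
    generalize MonoidAlgebra.of ℤ _ (Psi.plain τ a) = p at *
    generalize MonoidAlgebra.of ℤ _ (Psi.dot τ a) = d at *
    have h' : ∀ t : MonoidAlgebra ℤ (Psi τ), p * (d * t) = d * (p * t) := fun t => by
      rw [← mul_assoc, h, mul_assoc]
    simp only [mul_add, sub_mul, mul_sub, one_mul, mul_assoc, h']
    abel

/-- Turaev's invariant `λ`: the value of `v_+` in the linear `α`-kei `ℤ[Ψ]`, the initial label
being `1`. -/
noncomputable def lambdaInv {α 𝒜 : Type*} [DecidableEq 𝒜] (τ : α → α) (w : Nanoword 𝒜 α) :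
    MonoidAlgebra ℤ (Psi τ) :=
  FreeKei.lift (linearKei τ) 1 (vPlus τ w)

/-! Both halves are computations with explicit words. On the side of Turaev's invariants, reading
ABCD in ABCDCDAB produces the labels x₀, τ(c)x₀, τ(c)²x₀, τ(c)x₀, x₀. By the axiom (x *_c y)
*_{τ(c)} cy = x, the second A then undoes the second D, and the second B undoes the second C, so the
word ends at x₀ as the empty word does. In the linear kei, ABACBC and ACAC give the same polynomial
in c and c_• (`lambdaInv_ABACBC`).

On the side of homology, the bidegrees are chosen so that few states survive, all with only negative
circles. For ABCDCDAB there is one state S₀ in bidegree (0,3), there are two states T₁, T₂ in (1,3),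
and none in (2,3). Two negative circles of S₀ merge on passing to either Tₖ, so d(S₀) = T₁ + T₂ and
the homology is ℤ/2 (`KH_equiv_of_states`). ABACBC shows the same pattern in bidegrees (-1,2),
(0,2), (1,2), while ∅ and ACAC have no state at all in the bidegree in question.

These counts become finite checks once circles, which are quotient classes, are replaced by the
computable labels `arcLabel`, and once the classically defined alphabet of `reduceL` is replaced by
an explicit one (`reduceL_induction`). -/

/-! ## Connected components of a finite list of pairs -/

/-- A labelling of `X` that is constant exactly on the classes of the equivalence relation generated
by a list of pairs. -/
def pairLabel {X : Type*} [DecidableEq X] : List (X × X) → X → X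
  | [], x => x
  | (a, b) :: l, x => if pairLabel l x = pairLabel l b then pairLabel l a else pairLabel l x

theorem pairLabel_eq_of_mem {X : Type*} [DecidableEq X] {l : List (X × X)} {a b : X}
    (h : (a, b) ∈ l) : pairLabel l a = pairLabel l b := by
  induction l with
  | nil => simp at h
  | cons e l ih =>
    obtain ⟨c, d⟩ := e
    rcases List.mem_cons.1 h with h | h
    · obtain ⟨rfl, rfl⟩ := Prod.mk.inj h
      simp [pairLabel]
    · simp only [pairLabel, ih h]

/-- Adding a pair (a, b) only renames the label of the class of b to that of a, so a new coincidence
of labels is explained by a path through this pair. -/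
theorem eqvGen_of_pairLabel_eq {X : Type*} [DecidableEq X] {r : X → X → Prop} {l : List (X × X)}
    (hl : ∀ a b, (a, b) ∈ l → r a b) {x y : X} (h : pairLabel l x = pairLabel l y) :
    Relation.EqvGen r x y := by
  induction l generalizing x y with
  | nil => obtain rfl : x = y := h; exact .refl _
  | cons e l ih =>
    obtain ⟨a, b⟩ := e
    have ih' := fun {x y} => @ih (fun a b h => hl a b (List.mem_cons_of_mem _ h)) x y
    have hab : Relation.EqvGen r a b := .rel _ _ (hl a b List.mem_cons_self)
    simp only [pairLabel] at h
    -- Only the two mixed cases, where exactly one of x, y lies in the old class of b, use the new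
    -- pair.
    split_ifs at h with h₁ h₂ h₂
    · exact ih' (h₁.trans h₂.symm)
    · exact ((ih' h₁).trans _ _ _ hab.symm).trans _ _ _ (ih' h)
    · exact (ih' h).trans _ _ _ (hab.trans _ _ _ (ih' h₂).symm)
    · exact ih' h

namespace Nanophrase

variable {𝒜 : Type*} [DecidableEq 𝒜]

/-! ## An explicit labelling of the circles of a state -/

/-- The list of all places. -/
def placeList (P : Nanophrase 𝒜 ℤˣ) : List P.Place :=
  (List.finRange _).flatMap fun k => (List.finRange _).map (Sigma.mk k)

theorem mem_placeList (P : Nanophrase 𝒜 ℤˣ) (p : P.Place) : p ∈ P.placeList := by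
  obtain ⟨k, i⟩ := p
  simp [placeList]

/-- The list of the pairs of arcs joined in the state `s`. -/
def joinedPairs (P : Nanophrase 𝒜 ℤˣ) (s : 𝒜 → ℤˣ) : List (P.Arc × P.Arc) :=
  P.placeList.flatMap fun p => P.placeList.flatMap fun q =>
    if p ≠ q ∧ P.letter p = P.letter q then
      if s (P.letter p) = P.proj (P.letter p) then [(P.arcIn p, P.arcOut q)]
      else [(P.arcIn p, P.arcIn q), (P.arcOut p, P.arcOut q)]
    else []

theorem mem_joinedPairs {P : Nanophrase 𝒜 ℤˣ} {s : 𝒜 → ℤˣ} {x y : P.Arc} :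
    (x, y) ∈ P.joinedPairs s ↔ P.Joined s x y := by
  simp only [joinedPairs, List.mem_flatMap, mem_placeList, true_and]
  constructor
  · rintro ⟨p, q, h⟩
    split_ifs at h with h₁ h₂
    · obtain ⟨rfl, rfl⟩ := Prod.mk.inj (List.mem_singleton.1 h)
      exact .along p q h₁.1 h₁.2 h₂
    · have h₃ := Int.units_ne_iff_eq_neg.1 h₂
      simp only [List.mem_cons, List.not_mem_nil, or_false, Prod.mk.injEq] at h
      rcases h with ⟨rfl, rfl⟩ | ⟨rfl, rfl⟩
      · exact .ends p q h₁.1 h₁.2 h₃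
      · exact .starts p q h₁.1 h₁.2 h₃
    · simp at h
  · rintro (⟨p, q, hne, hl, hs⟩ | ⟨p, q, hne, hl, hs⟩ | ⟨p, q, hne, hl, hs⟩) <;> refine ⟨p, q, ?_⟩
    · rw [if_pos ⟨hne, hl⟩, if_pos hs]; simp
    · rw [if_pos ⟨hne, hl⟩, if_neg (Int.units_ne_iff_eq_neg.2 hs)]; simp
    · rw [if_pos ⟨hne, hl⟩, if_neg (Int.units_ne_iff_eq_neg.2 hs)]; simp

/-- A labelling of the arcs which is constant exactly on the circles of the state `s`. -/
def arcLabel (P : Nanophrase 𝒜 ℤˣ) (s : 𝒜 → ℤˣ) : P.Arc → P.Arc := pairLabel (P.joinedPairs s)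

/-- This makes equality of circles decidable by evaluation. -/
theorem arcLabel_eq_iff {P : Nanophrase 𝒜 ℤˣ} {s : 𝒜 → ℤˣ} {x y : P.Arc} :
    P.arcLabel s x = P.arcLabel s y ↔ P.circleOf s x = P.circleOf s y := by
  constructor
  · exact fun h => Quot.eqvGen_sound (eqvGen_of_pairLabel_eq (fun _ _ => mem_joinedPairs.1) h)
  · intro h
    exact congrArg (Quot.lift (P.arcLabel s)
      fun _ _ h => pairLabel_eq_of_mem (mem_joinedPairs.2 h)) h

/-- The number of circles of the state `s`, computed from the labelling of the arcs. -/
def circleCount (P : Nanophrase 𝒜 ℤˣ) (s : 𝒜 → ℤˣ) : ℕ :=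
  (Finset.univ.image (P.arcLabel s)).card

theorem card_circle (P : Nanophrase 𝒜 ℤˣ) (s : 𝒜 → ℤˣ) :
    Fintype.card (P.Circle s) = P.circleCount s := by
  classical
  let f : P.Circle s → P.Arc :=
    Quot.lift (P.arcLabel s) fun _ _ h => pairLabel_eq_of_mem (mem_joinedPairs.2 h)
  have hf : Function.Injective f := by
    rintro ⟨x⟩ ⟨y⟩ h
    exact arcLabel_eq_iff (P := P) |>.1 h
  rw [circleCount, ← Finset.card_univ, ← Finset.card_image_of_injective _ hf]
  congr 1
  ext x
  simp only [Finset.mem_image, Finset.mem_univ, true_and]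
  exact ⟨fun ⟨c, h⟩ => by obtain ⟨y, rfl⟩ := Quot.exists_rep c; exact ⟨y, h⟩,
    fun ⟨y, h⟩ => ⟨Quot.mk _ y, h⟩⟩

/-- The arcs that start or end at the letter `A`. -/
def arcsAt (P : Nanophrase 𝒜 ℤˣ) (A : 𝒜) : List P.Arc :=
  P.placeList.flatMap fun p => if P.letter p = A then [P.arcIn p, P.arcOut p] else []

theorem mem_circlesAt {P : Nanophrase 𝒜 ℤˣ} {s : 𝒜 → ℤˣ} {A : 𝒜}
    {c : P.Circle s} : c ∈ P.circlesAt s A ↔ ∃ x ∈ P.arcsAt A, c = P.circleOf s x := by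
  simp only [circlesAt, arcsAt, List.mem_flatMap, mem_placeList, true_and, Set.mem_ofPred_eq]
  constructor
  · rintro ⟨p, h, rfl | rfl⟩
    · exact ⟨P.arcIn p, ⟨p, by simp [h]⟩, rfl⟩
    · exact ⟨P.arcOut p, ⟨p, by simp [h]⟩, rfl⟩
  · rintro ⟨x, ⟨p, hx⟩, rfl⟩
    split_ifs at hx with h
    · refine ⟨p, h, ?_⟩
      simp only [List.mem_cons, List.not_mem_nil, or_false] at hx
      rcases hx with rfl | rfl <;> simp
    · simp at hx

/-! ## States with negative circles -/

namespace EnhancedState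

/-- The enhanced state with the given markers all of whose circles are negative. -/
def allNeg (P : Nanophrase 𝒜 ℤˣ) (s : 𝒜 → ℤˣ) : P.EnhancedState := ⟨s, fun _ => -1⟩

/-- The witness r is the number of positive circles. The bidegree depends on the signs only through
r, and r = 0 leaves no choice of signs. -/
theorem tau_eq {P : Nanophrase 𝒜 ℤˣ} (S : P.EnhancedState) :
    ∃ r ≤ P.circleCount S.mark, S.tau = 2 * r - P.circleCount S.mark ∧
      (r = 0 → S = allNeg P S.mark) := by
  classical
  refine ⟨(Finset.univ.filter fun c => S.sgn c = 1).card, ?_, ?_, ?_⟩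
  · rw [← card_circle]
    exact Finset.card_le_univ _
  · have h : ∀ c, ((S.sgn c : ℤˣ) : ℤ) = 2 * (if S.sgn c = 1 then 1 else 0) - 1 := by
      intro c
      rcases Int.units_eq_one_or (S.sgn c) with h | h <;> simp [h]
    rw [tau, Finset.sum_congr rfl fun c _ => h c, ← card_circle]
    rw [Finset.sum_sub_distrib, ← Finset.mul_sum]
    simp
  · intro h
    rw [Finset.card_eq_zero, Finset.filter_eq_empty_iff] at h
    obtain ⟨s, t⟩ := S
    refine congrArg (Sigma.mk s) (funext fun c => ?_)
    exact (Int.units_eq_one_or _).resolve_left (h (Finset.mem_univ c))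

theorem tau_allNeg (P : Nanophrase 𝒜 ℤˣ) (s : 𝒜 → ℤˣ) :
    (allNeg P s).tau = -P.circleCount s := by
  rw [← card_circle]
  change ∑ c : P.Circle s, (((-1 : ℤˣ) : ℤˣ) : ℤ) = _
  simp

/-- Two circles of a state with negative circles merge at the letter `A`; a criterion in terms of the
labels of the arcs at `A`. -/
theorem incident_allNeg {P : Nanophrase 𝒜 ℤˣ} {s t : 𝒜 → ℤˣ} (A : 𝒜)
    (hs : s A = 1) (ht : t A = -1) (hst : ∀ B, B ≠ A → s B = t B)
    (h₁ : ∃ x ∈ P.arcsAt A, ∃ y ∈ P.arcsAt A, P.arcLabel s x ≠ P.arcLabel s y ∧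
      ∀ z ∈ P.arcsAt A, P.arcLabel s z = P.arcLabel s x ∨ P.arcLabel s z = P.arcLabel s y)
    (h₂ : ∃ x ∈ P.arcsAt A, ∀ z ∈ P.arcsAt A, P.arcLabel t z = P.arcLabel t x) :
    Incident (allNeg P s) (allNeg P t) := by
  -- All signs are -1, so circles away from A keep theirs and the merging rule is (-,-) → -. Only
  -- the geometry at A remains.
  refine ⟨A, hs, ht, hst, fun _ _ => rfl, Or.inl ?_⟩
  obtain ⟨x, hx, y, hy, hxy, h₁⟩ := h₁
  obtain ⟨u, hu, h₂⟩ := h₂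
  refine ⟨P.circleOf s x, P.circleOf s y, P.circleOf t u, fun h => hxy (arcLabel_eq_iff.2 h),
    ?_, ?_, Or.inl ⟨rfl, rfl, rfl⟩⟩
  · ext c
    refine mem_circlesAt.trans ⟨?_, ?_⟩
    · rintro ⟨z, hz, rfl⟩
      exact (h₁ z hz).imp arcLabel_eq_iff.1 arcLabel_eq_iff.1
    · rintro (rfl | rfl)
      exacts [⟨x, hx, rfl⟩, ⟨y, hy, rfl⟩]
  · ext c
    refine mem_circlesAt.trans ⟨?_, ?_⟩
    · rintro ⟨z, hz, rfl⟩
      exact arcLabel_eq_iff.1 (h₂ z hz)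
    · rintro rfl
      exact ⟨u, hu, rfl⟩

end EnhancedState

/-! ## Homology in bidegrees with few states -/

variable [Fintype 𝒜]

theorem subsingleton_KH (P : Nanophrase 𝒜 ℤˣ) (i j : ℤ) [IsEmpty (P.StateOfDeg i j)] :
    Subsingleton (P.KH i j) :=
  (QuotientAddGroup.mk_surjective).subsingleton

/-- If there are exactly two states in bidegree `(i, j)`, one in bidegree `(i - 1, j)`, incident to
both, and none in bidegree `(i + 1, j)`, then the homology is `ℤ/2`. -/
theorem KH_equiv_of_states (P : Nanophrase 𝒜 ℤˣ) (i j : ℤ) (S₀ : P.StateOfDeg (i - 1) j)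
    (T₁ T₂ : P.StateOfDeg i j) (hS : ∀ S, S = S₀) (hne : T₁ ≠ T₂) (hT : ∀ T, T = T₁ ∨ T = T₂)
    (hU : IsEmpty (P.StateOfDeg (i + 1) j)) (h₁ : S₀.1.Incident T₁.1) (h₂ : S₀.1.Incident T₂.1) :
    Nonempty (P.KH i j ≃+ ZMod 2) := by
  classical
  let φ : (P.differential i (i + 1) j).ker →+ ZMod 2 :=
    ((Finsupp.applyAddHom T₁ + Finsupp.applyAddHom T₂ : P.Chain i j →+ ZMod 2)).comp
      (P.differential i (i + 1) j).ker.subtype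
  have hφ (f) : φ f = f.1 T₁ + f.1 T₂ := rfl
  have hd (g : P.Chain (i - 1) j) (T) (hT : S₀.1.Incident T.1) :
      P.differential (i - 1) i j g T = g S₀ := by
    have hg : g = Finsupp.single S₀ (g S₀) := by
      ext S
      rw [hS S, Finsupp.single_eq_same]
    conv_lhs => rw [hg]
    simp only [differential, LinearMap.toAddMonoidHom_coe, Finsupp.linearCombination_single,
      Finsupp.smul_apply, Finsupp.finsetSum_apply]
    rw [Finset.sum_eq_single T]
    · simp [EnhancedState.incidence, hT]
    · intro b _ hb
      exact Finsupp.single_eq_of_ne' hb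
    · simp
  have hsurj : Function.Surjective φ := by
    intro a
    -- Every chain is a cycle, since the next chain group is trivial by `hU`.
    refine ⟨⟨Finsupp.single T₁ a, Subsingleton.elim _ _⟩, ?_⟩
    rw [hφ]
    simp [Finsupp.single_eq_of_ne' hne]
  -- The boundaries form the diagonal of (ℤ/2)², which in characteristic two is the kernel of the
  -- sum of coordinates.
  have hker : (P.differential (i - 1) i j).range.addSubgroupOf (P.differential i (i + 1) j).ker =
      φ.ker := by
    ext ⟨f, hf⟩
    rw [AddSubgroup.mem_addSubgroupOf, AddMonoidHom.mem_ker, hφ, CharTwo.add_eq_zero]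
    constructor
    · rintro ⟨g, hg⟩
      change _ = f at hg
      subst hg
      simp only [hd g _ h₁, hd g _ h₂]
    · intro h
      refine ⟨Finsupp.single S₀ (f T₁), ?_⟩
      ext T
      rcases hT T with rfl | rfl
      · rw [hd _ _ h₁, Finsupp.single_eq_same]
      · rw [hd _ _ h₂, Finsupp.single_eq_same]
        exact h
  exact ⟨(QuotientAddGroup.quotientAddEquivOfEq hker).trans
    (QuotientAddGroup.quotientKerEquivOfSurjective φ hsurj)⟩

end Nanophrase

/-! ## Nanowords without letters of sign zero -/

/-- A nanoword over `{1, -1}`, seen as a nanophrase on the subtype of all letters. -/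
def Nanoword.onSubtype {𝒜 : Type*} [DecidableEq 𝒜] (v : Nanoword 𝒜 ℤˣ) (p : 𝒜 → Prop)
    (hp : ∀ A, p A) : Nanophrase {A // p A} ℤˣ where
  proj A := v.proj A.1
  words := [v.word.map fun A => ⟨A, hp A⟩]
  gauss B := by
    simpa using (@List.count_map_of_injective _ _ _ _ instBEqOfDecidableEq _ v.word
      (fun A => (⟨A, hp A⟩ : {A // p A})) (fun _ _ h => congrArg Subtype.val h) B.1).trans
        (v.gauss B.1)

theorem reduceL_eq_onSubtype {𝒜 α : Type*} [DecidableEq 𝒜] (τ : α → α) (L : Set α)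
    (w : Nanoword 𝒜 α) (v : Nanoword 𝒜 ℤˣ) (hword : v.word = w.word)
    (hsign : ∀ A, signL τ L (w.proj A) = v.proj A) :
    reduceL τ L w.toNanophrase =
      v.onSubtype (fun A => signL τ L (w.toNanophrase.proj A) ≠ 0)
        (fun A => (hsign A).trans_ne (v.proj A).ne_zero) := by
  have hp : ∀ A, signL τ L (w.toNanophrase.proj A) ≠ 0 :=
    fun A => (hsign A).trans_ne (v.proj A).ne_zero
  unfold reduceL Nanoword.onSubtype
  congr 1
  · funext A
    rw [show signL τ L (w.toNanophrase.proj A.1) = _ from hsign A.1]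
    rcases Int.units_eq_one_or (v.proj A.1) with h | h <;> simp [h]
  · simp only [Nanoword.toNanophrase, List.map_cons, List.map_nil, hword]
    congr 1
    rw [← List.filterMap_eq_map]
    refine List.filterMap_congr fun A _ => ?_
    exact dif_pos (hp A)

/-- Every property of the nanophrase on the trivial subtype holds on each subtype of all letters. -/
theorem Nanoword.onSubtype_induction {𝒜 : Type*} [DecidableEq 𝒜] (v : Nanoword 𝒜 ℤˣ)
    (M : ∀ (p : 𝒜 → Prop) [DecidablePred p], Nanophrase {A // p A} ℤˣ → Prop)
    (h : M (fun _ => True) (v.onSubtype _ fun _ => trivial)) (p : 𝒜 → Prop) [inst : DecidablePred p]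
    (hp : ∀ A, p A) : M p (v.onSubtype p hp) := by
  -- Equality of predicates, by propositional extensionality, also identifies the subtypes. The
  -- decision procedure is then replaced by one that evaluates.
  obtain rfl : p = fun _ => True := funext fun A => eq_true (hp A)
  obtain rfl : inst = fun _ => instDecidableTrue := Subsingleton.elim _ _
  exact h

/-- `signL` is classical, so nothing about `reduceL` can be evaluated directly. As no letter has
sign zero, none is deleted, and the claim moves to a concrete phrase. -/
theorem reduceL_induction {𝒜 α : Type*} [DecidableEq 𝒜] (τ : α → α) (L : Set α)
    (w : Nanoword 𝒜 α) (v : Nanoword 𝒜 ℤˣ) (hword : v.word = w.word)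
    (hsign : ∀ A, signL τ L (w.proj A) = v.proj A)
    (M : ∀ (p : 𝒜 → Prop) [DecidablePred p], Nanophrase {A // p A} ℤˣ → Prop)
    (h : M (fun _ => True) (v.onSubtype _ fun _ => trivial)) :
    M (fun A => signL τ L (w.toNanophrase.proj A) ≠ 0) (reduceL τ L w.toNanophrase) := by
  rw [reduceL_eq_onSubtype τ L w v hword hsign]
  exact v.onSubtype_induction M h _ _

/-! ### Enumeration of states by bidegree and the homology of the explicit words -/

open Nanophrase EnhancedState

/-- The nanoword `ABCDCDAB` with signs `-, -, +, +`, on the trivial subtype. -/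
abbrev phraseABCDCDAB : Nanophrase {_A : Fin 4 // True} ℤˣ :=
  (nanowordABCDCDAB (-1 : ℤˣ) (-1) 1 1).onSubtype _ fun _ => trivial

/-- The nanoword `ABACBC` with signs `+, -, +`, on the trivial subtype. -/
abbrev phraseABACBC : Nanophrase {_A : Fin 3 // True} ℤˣ :=
  (nanowordABACBC (1 : ℤˣ) (-1) 1).onSubtype _ fun _ => trivial

/-- The nanoword `ACAC` with signs `+, +`, on the trivial subtype. -/
abbrev phraseACAC : Nanophrase {_A : Fin 2 // True} ℤˣ :=
  (nanowordACAC (1 : ℤˣ) 1).onSubtype _ fun _ => trivial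

/-- The degree `i` of the states with markers `s`. -/
def Nanophrase.markDeg {𝒜 : Type*} [DecidableEq 𝒜] [Fintype 𝒜] (P : Nanophrase 𝒜 ℤˣ)
    (s : 𝒜 → ℤˣ) : ℤ :=
  (P.writhe - ∑ A, (s A : ℤ)) / 2

/-- A state with markers `s` of which exactly `r` circles are positive has bidegree `(i, j)`. -/
def Nanophrase.HasDeg {𝒜 : Type*} [DecidableEq 𝒜] [Fintype 𝒜] (P : Nanophrase 𝒜 ℤˣ)
    (s : 𝒜 → ℤˣ) (r : ℕ) (i j : ℤ) : Prop :=
  P.markDeg s = i ∧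
    -((∑ A, (s A : ℤ) + 2 * (2 * r - P.circleCount s) - 3 * P.writhe) / 2) = j

instance {𝒜 : Type*} [DecidableEq 𝒜] [Fintype 𝒜] (P : Nanophrase 𝒜 ℤˣ) (s : 𝒜 → ℤˣ) (r : ℕ)
    (i j : ℤ) : Decidable (P.HasDeg s r i j) :=
  inferInstanceAs (Decidable (_ ∧ _))

/-- Reduces the search over sign functions on circles to a search over markers and a bounded number
r. -/
theorem Nanophrase.exists_hasDeg {𝒜 : Type*} [DecidableEq 𝒜] [Fintype 𝒜] {P : Nanophrase 𝒜 ℤˣ}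
    {i j : ℤ} (S : P.StateOfDeg i j) : ∃ r ∈ List.range (P.circleCount S.1.mark + 1),
      P.HasDeg S.1.mark r i j ∧ (r = 0 → S.1 = allNeg P S.1.mark) := by
  obtain ⟨r, hr, ht, h⟩ := tau_eq S.1
  refine ⟨r, List.mem_range.2 (Nat.lt_succ_of_le hr), ⟨S.2.1, ?_⟩, h⟩
  rw [← ht]
  exact S.2.2

theorem Nanophrase.isEmpty_stateOfDeg {𝒜 : Type*} [DecidableEq 𝒜] [Fintype 𝒜]
    {P : Nanophrase 𝒜 ℤˣ} {i j : ℤ}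
    (h : ∀ s, P.markDeg s = i → ∀ r ∈ List.range (P.circleCount s + 1), ¬ P.HasDeg s r i j) :
    IsEmpty (P.StateOfDeg i j) :=
  ⟨fun S => let ⟨r, hr, hd, _⟩ := exists_hasDeg S; h _ hd.1 r hr hd⟩

/-- The state with markers `s` and negative circles, in its bidegree. -/
def Nanophrase.HasDeg.state {𝒜 : Type*} [DecidableEq 𝒜] [Fintype 𝒜] {P : Nanophrase 𝒜 ℤˣ}
    {s : 𝒜 → ℤˣ} {i j : ℤ} (h : P.HasDeg s 0 i j) : P.StateOfDeg i j :=
  ⟨allNeg P s, h.1, by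
    rw [degJ, tau_allNeg]
    have h₂ := h.2
    rw [Nat.cast_zero, mul_zero, zero_sub] at h₂
    exact h₂⟩

theorem Nanophrase.eq_state {𝒜 : Type*} [DecidableEq 𝒜] [Fintype 𝒜] {P : Nanophrase 𝒜 ℤˣ}
    {i j : ℤ} {l : List (𝒜 → ℤˣ)}
    (h : ∀ s, P.markDeg s = i → ∀ r ∈ List.range (P.circleCount s + 1),
      P.HasDeg s r i j → r = 0 ∧ s ∈ l)
    (S : P.StateOfDeg i j) : S.1.mark ∈ l ∧ S.1 = allNeg P S.1.mark := by
  obtain ⟨r, hr, hd, h0⟩ := exists_hasDeg S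
  obtain ⟨hr0, hs⟩ := h _ hd.1 r hr hd
  exact ⟨hs, h0 hr0⟩

/-- The homology is `ℤ/2` if all states in bidegrees `(i - 1, j)`, `(i, j)`, `(i + 1, j)` have negative
circles, and there are one, two and none of them, respectively, the first being incident to the
others. -/
theorem Nanophrase.KH_equiv_of_markers {𝒜 : Type*} [DecidableEq 𝒜] [Fintype 𝒜]
    (P : Nanophrase 𝒜 ℤˣ) (i j : ℤ) (s t₁ t₂ : 𝒜 → ℤˣ) (hne : t₁ ≠ t₂)
    (hs : P.HasDeg s 0 (i - 1) j) (ht₁ : P.HasDeg t₁ 0 i j) (ht₂ : P.HasDeg t₂ 0 i j)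
    (h₀ : ∀ u, P.markDeg u = i - 1 → ∀ r ∈ List.range (P.circleCount u + 1),
      P.HasDeg u r (i - 1) j → r = 0 ∧ u ∈ [s])
    (h₁ : ∀ u, P.markDeg u = i → ∀ r ∈ List.range (P.circleCount u + 1),
      P.HasDeg u r i j → r = 0 ∧ u ∈ [t₁, t₂])
    (h₂ : ∀ u, P.markDeg u = i + 1 → ∀ r ∈ List.range (P.circleCount u + 1),
      ¬ P.HasDeg u r (i + 1) j)
    (hst₁ : Incident (allNeg P s) (allNeg P t₁)) (hst₂ : Incident (allNeg P s) (allNeg P t₂)) :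
    Nonempty (P.KH i j ≃+ ZMod 2) := by
  refine KH_equiv_of_states P i j hs.state ht₁.state ht₂.state (fun S => ?_)
    (fun h => hne (congrArg (fun T : P.StateOfDeg i j => T.1.mark) h)) (fun T => ?_)
    (isEmpty_stateOfDeg h₂) hst₁ hst₂
  · obtain ⟨hm, h⟩ := eq_state h₀ S
    rw [List.mem_singleton.1 hm] at h
    exact Subtype.ext h
  · obtain ⟨hm, h⟩ := eq_state h₁ T
    simp only [List.mem_cons, List.not_mem_nil, or_false] at hm
    rcases hm with hm | hm <;> rw [hm] at h
    exacts [Or.inl (Subtype.ext h), Or.inr (Subtype.ext h)]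

/-- Here w = 0, so j = 3 forces τ(S) = -3, -2, -1 for i = 0, 1, 2. Giving every letter the marker
opposite to its projection yields three circles; flipping A or B merges two of them. Flipping both
leaves two circles, so τ(S) = -1 is impossible in degree 2. -/
theorem KH_phraseABCDCDAB : Nonempty (phraseABCDCDAB.KH 1 3 ≃+ ZMod 2) := by
  refine KH_equiv_of_markers _ 1 3 (fun A => ![1, 1, -1, -1] A.1) (fun A => ![1, -1, -1, -1] A.1)
    (fun A => ![-1, 1, -1, -1] A.1) (by decide) (by decide +kernel) (by decide +kernel)
    (by decide +kernel) (by decide +kernel) (by decide +kernel) (by decide +kernel)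
    -- The flipped letters are B and A respectively.
    (incident_allNeg ⟨1, trivial⟩ ?_ ?_ ?_ ?_ ?_) (incident_allNeg ⟨0, trivial⟩ ?_ ?_ ?_ ?_ ?_) <;>
  decide +kernel

/-- Here w = 1, so j = 2 forces τ(S) = -2, -1, 0 for i = -1, 0, 1. The all-positive markers give two
circles, which merge when A or C is flipped; flipping B leaves two. In degree 1 every state has a
single circle, so τ(S) = 0 is impossible. -/
theorem KH_phraseABACBC : Nonempty (phraseABACBC.KH 0 2 ≃+ ZMod 2) := by
  refine KH_equiv_of_markers _ 0 2 (fun A => ![1, 1, 1] A.1) (fun A => ![1, 1, -1] A.1)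
    (fun A => ![-1, 1, 1] A.1) (by decide) (by decide +kernel) (by decide +kernel)
    (by decide +kernel) (by decide +kernel) (by decide +kernel) (by decide +kernel)
    (incident_allNeg ⟨2, trivial⟩ ?_ ?_ ?_ ?_ ?_) (incident_allNeg ⟨0, trivial⟩ ?_ ?_ ?_ ?_ ?_) <;>
  decide +kernel

/-- The bidegree forces positive markers and τ(S) = 0, but these markers give a single circle. -/
theorem subsingleton_KH_phraseACAC : Subsingleton (phraseACAC.KH 0 2) := by
  have := isEmpty_stateOfDeg (P := phraseACAC) (i := 0) (j := 2) (by decide +kernel)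
  exact subsingleton_KH _ _ _

/-! ## The signs of the letters -/

theorem signL_of_mem {α : Type*} {τ : α → α} {L : Set α} {c : α} (hcL : c ∈ L) (hc : τ c ≠ c) :
    signL τ L c = 1 :=
  if_pos ⟨hcL, hc⟩

theorem signL_tau_of_mem {α : Type*} {τ : α → α} (hτ : Function.Involutive τ) {R : Set α}
    (hR : IsCompleteResidueSystem τ R) {L : Set α} (hL : L ⊆ R) {c : α} (hcL : c ∈ L)
    (hc : τ c ≠ c) : signL τ L (τ c) = -1 := by
  -- Otherwise c and τ(c) would be two representatives of one orbit in R.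
  have hn : τ c ∉ L := fun h =>
    hc ((hR c).unique ⟨hL h, Or.inr rfl⟩ ⟨hL hcL, Or.inl rfl⟩)
  rw [signL, if_neg fun h => hn h.1, if_pos ⟨Set.mem_image_of_mem τ hcL, fun h => hc (hτ.injective h)⟩]

/-! ## Turaev's invariants of the nanowords -/

/-- The walk uses only kei operations, so a homomorphism may be applied at the start, to the label
and the stored labels, instead of at the end. The invariants can thus be computed in the target kei.
-/
theorem FreeKei.lift_keiWalk {α 𝒜 X : Type*} [DecidableEq 𝒜] {τ : α → α} (K : AlphaKei τ X)
    (x₀ : X) (proj : 𝒜 → α) (w : List 𝒜) (m : 𝒜 → Option (FreeKei τ)) (x : FreeKei τ) :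
    FreeKei.lift K x₀ (keiWalk (FreeKei.kei τ) proj w m x) =
      keiWalk K proj w (fun A => (m A).map (FreeKei.lift K x₀)) (FreeKei.lift K x₀ x) := by
  induction w generalizing m x with
  | nil => rfl
  | cons A w ih =>
    have hact : ∀ a x, lift K x₀ ((kei τ).act a x) = K.act a (lift K x₀ x) := by
      rintro a ⟨x⟩; rfl
    have hop : ∀ a x y, lift K x₀ ((kei τ).op a x y) = K.op a (lift K x₀ x) (lift K x₀ y) := by
      rintro a ⟨x⟩ ⟨y⟩; rfl
    rcases h : m A with _ | y
    · simp only [keiWalk, h, Option.map_none, ih, hact]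
      congr 1
      funext B
      by_cases hB : B = A
      · subst hB; simp
      · simp [hB]
    · simp only [keiWalk, h, Option.map_some, ih, hop]

theorem fvPlus_eq {α 𝒜 : Type*} [DecidableEq 𝒜] (τ : α → α) (w : Nanoword 𝒜 α) :
    fvPlus τ w = keiWalk (groupKei τ) w.proj w.word (fun _ => none) (FreeGroup.of 1) :=
  FreeKei.lift_keiWalk ..

theorem lambdaInv_eq {α 𝒜 : Type*} [DecidableEq 𝒜] (τ : α → α) (w : Nanoword 𝒜 α) :
    lambdaInv τ w = keiWalk (linearKei τ) w.proj w.word (fun _ => none) 1 :=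
  FreeKei.lift_keiWalk ..

/-- The label before A is c times the label before D, and likewise for B and C, so the last two
operations invert the two before them. -/
theorem fvPlus_ABCDCDAB {α : Type*} (τ : α → α) (c : α) :
    fvPlus τ (nanowordABCDCDAB (τ c) (τ c) c c) = FreeGroup.of 1 := by
  rw [fvPlus_eq]
  simp [keiWalk, nanowordABCDCDAB, groupKei, Psi.plain_tau, Psi.dot_tau, Psi.shift]

theorem keiWalk_ABACBC {α X : Type*} {τ : α → α} (K : AlphaKei τ X) (a b c : α) (x : X) :
    keiWalk K (nanowordABACBC a b c).proj (nanowordABACBC a b c).word (fun _ => none) x =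
      K.op c (K.op b (K.act c (K.op a (K.act b (K.act a x)) x)) (K.act a x))
        (K.op a (K.act b (K.act a x)) x) := by
  simp [keiWalk, nanowordABACBC]

theorem keiWalk_ACAC {α X : Type*} {τ : α → α} (K : AlphaKei τ X) (a c : α) (x : X) :
    keiWalk K (nanowordACAC a c).proj (nanowordACAC a c).word (fun _ => none) x =
      K.op c (K.op a (K.act c (K.act a x)) x) (K.act a x) := by
  simp [keiWalk, nanowordACAC]

/-- With p = c and d = c_•, both sides equal d²p² - d²p - dp² + d + p. -/
theorem lambdaInv_ABACBC {α : Type*} (τ : α → α) (c : α) :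
    lambdaInv τ (nanowordABACBC c (τ c) c) = lambdaInv τ (nanowordACAC c c) := by
  have hc := Psi.comm (τ := τ) c
  have hc' : MonoidAlgebra.of ℤ _ (Psi.plain τ c) * MonoidAlgebra.of ℤ _ (Psi.dot τ c) =
      MonoidAlgebra.of ℤ _ (Psi.dot τ c) * MonoidAlgebra.of ℤ _ (Psi.plain τ c) := by
    rw [← map_mul, ← map_mul, hc]
  have hp : MonoidAlgebra.of ℤ _ (Psi.plain τ (τ c)) * MonoidAlgebra.of ℤ _ (Psi.plain τ c) = 1 := by
    rw [← map_mul, Psi.plain_tau, inv_mul_cancel, map_one]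
  have hd : MonoidAlgebra.of ℤ _ (Psi.dot τ c) * MonoidAlgebra.of ℤ _ (Psi.dot τ (τ c)) = 1 := by
    rw [← map_mul, Psi.dot_tau, mul_inv_cancel, map_one]
  rw [lambdaInv_eq, lambdaInv_eq, keiWalk_ABACBC, keiWalk_ACAC]
  have hact : ∀ a x, (linearKei τ).act a x = MonoidAlgebra.of ℤ _ (Psi.plain τ a) * x :=
    fun _ _ => rfl
  have hop : ∀ a x y, (linearKei τ).op a x y = MonoidAlgebra.of ℤ _ (Psi.dot τ a) * x +
      (1 - MonoidAlgebra.of ℤ _ (Psi.dot τ a) * MonoidAlgebra.of ℤ _ (Psi.plain τ a)) * y :=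
    fun _ _ _ => rfl
  simp only [hact, hop]
  clear hact hop
  -- What remains is an identity in a noncommutative ring that needs only pd = dp, p'p = 1 and dd' =
  -- 1.
  generalize MonoidAlgebra.of ℤ _ (Psi.plain τ c) = p at *
  generalize MonoidAlgebra.of ℤ _ (Psi.dot τ c) = d at *
  generalize MonoidAlgebra.of ℤ _ (Psi.plain τ (τ c)) = p' at *
  generalize MonoidAlgebra.of ℤ _ (Psi.dot τ (τ c)) = d' at *
  have h₁ : ∀ t, p * (d * t) = d * (p * t) := fun t => by rw [← mul_assoc, hc', mul_assoc]
  have h₂ : ∀ t, d * (d' * t) = t := fun t => by rw [← mul_assoc, hd, one_mul]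
  simp only [mul_add, sub_mul, mul_sub, one_mul, mul_one, mul_assoc, hc', h₁, h₂, hp, hd]
  abel

/-! ### The empty word and the main theorem -/

theorem subsingleton_KH_empty {α : Type*} (τ : α → α) (L : Set α) :
    Subsingleton ((reduceL τ L (emptyNanoword α).toNanophrase).KH 1 3) := by
  have : IsEmpty ((reduceL τ L (emptyNanoword α).toNanophrase).StateOfDeg 1 3) := by
    refine ⟨fun S => ?_⟩
    -- Without letters every state has i = 0, not 1.
    have h := S.2.1
    simp [degI, writhe, sigma] at h
  exact subsingleton_KH _ _ _

theorem mainTheorem6 {α : Type*} [Finite α] (τ : α → α) (hτ : Function.Involutive τ)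
    (R : Set α) (hR : IsCompleteResidueSystem τ R) (L : Set α) (hL : L ⊆ R)
    (c : α) (hcL : c ∈ L) (hc : τ c ≠ c) :
    -- `KH` of the reduction is not determined by `f ∘ v_+`
    (¬ ∀ (𝒜 ℬ : Type) [Fintype 𝒜] [DecidableEq 𝒜] [Fintype ℬ] [DecidableEq ℬ]
        (w : Nanoword 𝒜 α) (w' : Nanoword ℬ α), fvPlus τ w = fvPlus τ w' →
        ∀ i j : ℤ, Nonempty ((reduceL τ L w.toNanophrase).KH i j ≃+
          (reduceL τ L w'.toNanophrase).KH i j)) ∧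
    -- the words `ABCDCDAB` and `∅`
    (fvPlus τ (nanowordABCDCDAB (τ c) (τ c) c c) = fvPlus τ (emptyNanoword α) ∧
      fvPlus τ (emptyNanoword α) = FreeGroup.of 1 ∧
      Subsingleton ((reduceL τ L (emptyNanoword α).toNanophrase).KH 1 3) ∧
      Nonempty ((reduceL τ L (nanowordABCDCDAB (τ c) (τ c) c c).toNanophrase).KH 1 3
        ≃+ ZMod 2)) ∧
    -- the words `ABACBC` and `ACAC`
    (lambdaInv τ (nanowordABACBC c (τ c) c) = lambdaInv τ (nanowordACAC c c) ∧
      Subsingleton ((reduceL τ L (nanowordACAC c c).toNanophrase).KH 0 2) ∧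
      Nonempty ((reduceL τ L (nanowordABACBC c (τ c) c).toNanophrase).KH 0 2
        ≃+ ZMod 2)) := by
  have hc₁ := signL_of_mem hcL hc
  have hc₂ := signL_tau_of_mem hτ hR hL hcL hc
  have hfv : fvPlus τ (nanowordABCDCDAB (τ c) (τ c) c c) = fvPlus τ (emptyNanoword α) :=
    fvPlus_ABCDCDAB τ c
  have h₀ := subsingleton_KH_empty τ L
  have h₁ : Nonempty ((reduceL τ L (nanowordABCDCDAB (τ c) (τ c) c c).toNanophrase).KH 1 3
      ≃+ ZMod 2) := by
    refine reduceL_induction τ L _ (nanowordABCDCDAB (-1) (-1) 1 1) rfl ?_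
      (fun _ _ P => Nonempty (P.KH 1 3 ≃+ ZMod 2)) KH_phraseABCDCDAB
    intro A
    fin_cases A <;> simpa [nanowordABCDCDAB]
  have h₂ : Subsingleton ((reduceL τ L (nanowordACAC c c).toNanophrase).KH 0 2) := by
    refine reduceL_induction τ L _ (nanowordACAC 1 1) rfl ?_
      (fun _ _ P => Subsingleton (P.KH 0 2)) subsingleton_KH_phraseACAC
    intro A
    fin_cases A <;> simpa [nanowordACAC]
  have h₃ : Nonempty ((reduceL τ L (nanowordABACBC c (τ c) c).toNanophrase).KH 0 2
      ≃+ ZMod 2) := by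
    refine reduceL_induction τ L _ (nanowordABACBC 1 (-1) 1) rfl ?_
      (fun _ _ P => Nonempty (P.KH 0 2 ≃+ ZMod 2)) KH_phraseABACBC
    intro A
    fin_cases A <;> simpa [nanowordABACBC]
  refine ⟨fun h => ?_, ⟨hfv, rfl, h₀, h₁⟩, lambdaInv_ABACBC τ c, h₂, h₃⟩
  obtain ⟨e⟩ := h (Fin 4) (Fin 0) _ _ hfv 1 3
  obtain ⟨e₁⟩ := h₁
  -- An isomorphism would embed ℤ/2 into the trivial group of the empty word.
  exact zero_ne_one (α := ZMod 2) ((e₁.symm.trans e).injective (h₀.elim _ _))
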